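/- Let $T=(V,E)$ be a free tree with $n=|V|\ge 1$ vertices. A linear arrangement of $T$ is a bijection $\pi:V\to\{1,\dots,n\}$, and $D_\pi(T)=\sum_{uv\in E}|\pi(u)-\pi(v)|$ is its sum of edge lengths. The arrangement $\pi$ is planar if there are no two edges $\{s,t\},\{u,v\}\in E$ with $\pi(s)<\pi(u)<\pi(t)<\pi(v)$. For $r\in V$ let $T^r$ denote $T$ rooted at $r$; the arrangement $\pi$ is a projective arrangement of $T^r$ if it is planar and there is no edge $\{s,t\}\in E$ with $\pi(s)<\pi(r)<\pi(t)$. Let $\mathbb{E}_{\mathrm{pl}}[D(T)]$ be the expected value of $D_\pi(T)$ for $\pi$ uniformly random among the planar arrangements of $T$, let $\mathbb{E}_{\mathrm{pr}}[D(T^u)]$ be the expected value of $D_\pi(T)$ for $\pi$ uniformly random among the projective arrangements of $T^u$, and let $\mathbb{E}^{\ast}_{\mathrm{pr}}[D(T^u)]$ be the expected value of $D_\pi(T)$ for $\pi$ uniformly random among the projective arrangements of $T^u$ with $\pi(u)=1$. Then all these sets of arrangements are nonempty (so that the expectations are defined), and $$\mathbb{E}_{\mathrm{pl}}[D(T)]=\frac1n\sum_{u\in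 V}\mathbb{E}^{\ast}_{\mathrm{pr}}[D(T^u)]=\frac{(n-1)(n-2)}{6n}+\frac1n\sum_{u\in V}\mathbb{E}_{\mathrm{pr}}[D(T^u)].$$ -/

import Mathlib

namespace LinArr

/-- Linear arrangements of a finite vertex set `V` with `n` elements: bijections from `V` onto
the `n` positions. The positions `1, …, n` are encoded by `Fin n` shifted by one, see `pos`. -/
abbrev Arrangement (V : Type*) [Fintype V] := V ≃ Fin (Fintype.card V)

variable {V : Type*} [Fintype V]

/-- The position of the vertex `u` in the arrangement `π`, an integer in `{1, …, n}`. -/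
def pos (π : Arrangement V) (u : V) : ℕ := (π u : ℕ) + 1

/-- `π` is planar: no two edges `{s, t}`, `{u, v}` cross, that is, satisfy
`π(s) < π(u) < π(t) < π(v)`. -/
def IsPlanar (G : SimpleGraph V) (π : Arrangement V) : Prop :=
  ∀ s t u v : V, G.Adj s t → G.Adj u v →
    ¬ (pos π s < pos π u ∧ pos π u < pos π t ∧ pos π t < pos π v)

/-- The vertex `r` is covered by some edge `{s, t}` in `π`. Both orientations of the edge are
included since `G.Adj` is symmetric. -/
def IsCovered (G : SimpleGraph V) (r : V) (π : Arrangement V) : Prop :=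
  ∃ s t : V, G.Adj s t ∧ pos π s < pos π r ∧ pos π r < pos π t

/-- `π` is projective for `G` rooted at `r`: it is planar and the root is not covered. -/
def IsProjective (G : SimpleGraph V) (r : V) (π : Arrangement V) : Prop :=
  IsPlanar G π ∧ ¬ IsCovered G r π

/-- The length `|π(u) - π(v)|` of the edge `e = {u, v}` in `π`. -/
def edgeLength (π : Arrangement V) (e : Sym2 V) : ℝ :=
  Sym2.lift ⟨fun u v => |(pos π u : ℝ) - (pos π v : ℝ)|, fun _ _ => abs_sub_comm _ _⟩ e

open Classical in
/-- The sum `D` of the edge lengths in `π`. -/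
noncomputable def sumEdgeLengths (G : SimpleGraph V) (π : Arrangement V) : ℝ :=
  ∑ e ∈ G.edgeFinset, edgeLength π e

open Classical in
/-- The set of planar arrangements of `G`. -/
noncomputable def planarArrangements (G : SimpleGraph V) : Finset (Arrangement V) :=
  Finset.univ.filter fun π => IsPlanar G π

open Classical in
/-- The set of projective arrangements of `G` rooted at `r`. -/
noncomputable def projectiveArrangements (G : SimpleGraph V) (r : V) :
    Finset (Arrangement V) :=
  Finset.univ.filter fun π => IsProjective G r π

open Classical in
/-- The set of projective arrangements of `G` rooted at `r` with the root in the first position. -/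
noncomputable def projectiveArrangementsFixed (G : SimpleGraph V) (r : V) :
    Finset (Arrangement V) :=
  (projectiveArrangements G r).filter fun π => pos π r = 1

/-- Expected sum of edge lengths in a uniformly random planar arrangement of `G`. -/
noncomputable def expPlanar (G : SimpleGraph V) : ℝ :=
  (planarArrangements G).expect fun π => sumEdgeLengths G π

/-- Expected sum of edge lengths in a uniformly random projective arrangement of `G` rooted
at `r`. -/
noncomputable def expProjective (G : SimpleGraph V) (r : V) : ℝ :=
  (projectiveArrangements G r).expect fun π => sumEdgeLengths G π

/-- Expected sum of edge lengths in a uniformly random projective arrangement of `G` rooted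
at `r` among those with `r` in the first position. -/
noncomputable def expProjectiveFixed (G : SimpleGraph V) (r : V) : ℝ :=
  (projectiveArrangementsFixed G r).expect fun π => sumEdgeLengths G π

end LinArr

/- Rotating a planar arrangement cyclically keeps it planar, so each vertex is first in the same
number of planar arrangements, and a planar arrangement with `u` first is projective for `T^u`.
Averaging over `u` gives the first equality.

To compare `E*` with `E` at a fixed root `u`, split `D` into the edges at `u` and the others. All
permutations of the blocks formed by `{u}` and the branches at `u` act on the projective
arrangements, and the other edges lie inside blocks, so their lengths have the same mean in both
models. For an edge `uv`, reflection gives mean length `n / 2` when `u` is first. Otherwise the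
length is one plus the number of vertices between `u` and `v`, where a vertex `x` is between them
with probability `1 / 2` if `x ≠ v` lies in the branch of `v`, and `1 / 3` if it lies in another
branch. The difference of the two means is one sixth of the number of vertices outside `u` and the
branch of `v`; summed over the neighbours `v` of `u` this is `(deg u - 1) (n - 1) / 6`, and summed
over `u` it is `(n - 1) (n - 2) / 6`. -/

namespace LinArr

open Finset

section Arrangement

variable {V : Type*} [Fintype V] {G : SimpleGraph V} {π ρ : Arrangement V} {r s t x y z : V}

/-- The arrangement that lists the vertices by increasing values of the key `f`. -/
noncomputable def ofKey {α : Type*} [LinearOrder α] (f : V → α) (hf : Function.Injective f) :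
    Arrangement V :=
  letI : LinearOrder V := LinearOrder.lift' f hf
  (Fintype.orderIsoFinOfCardEq V rfl).symm.toEquiv

theorem ofKey_lt_ofKey_iff {α : Type*} [LinearOrder α] {f : V → α} (hf : Function.Injective f) :
    ofKey f hf x < ofKey f hf y ↔ f x < f y := by
  let : LinearOrder V := LinearOrder.lift' f hf
  exact (Fintype.orderIsoFinOfCardEq V rfl).symm.lt_iff_lt

theorem eq_of_lt_iff_lt (h : ∀ x y, π x < π y ↔ ρ x < ρ y) : π = ρ := by
  have hle : ∀ x y, ρ x ≤ ρ y ↔ π x ≤ π y := fun x y => by rw [← not_lt, ← not_lt, h]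
  let e : Fin (Fintype.card V) ≃o Fin (Fintype.card V) :=
    ⟨π.symm.trans ρ, fun {a b} => by simp [hle]⟩
  have he : e = OrderIso.refl _ := Subsingleton.elim _ _
  ext x
  simpa [e] using congrArg Fin.val (DFunLike.congr_fun he (π x)).symm

/-- The vertex in the first position of `π`. -/
def first [Nonempty V] (π : Arrangement V) : V := π.symm ⟨0, Fintype.card_pos⟩

theorem first_eq_iff [Nonempty V] : first π = r ↔ (π r : ℕ) = 0 := by
  rw [first, Equiv.symm_apply_eq, Fin.ext_iff, eq_comm]

theorem not_lt_first [Nonempty V] : ¬ π x < π (first π) := by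
  simp [first]

/-- The vertex `z` lies strictly between `x` and `y` in `π`; symmetric in `x` and `y`. -/
def IsBetween (π : Arrangement V) (x z y : V) : Prop :=
  π x < π z ∧ π z < π y ∨ π y < π z ∧ π z < π x

theorem isBetween_comm : IsBetween π x z y ↔ IsBetween π y z x := or_comm

theorem IsBetween.ne_left (h : IsBetween π x z y) : z ≠ x := by
  rintro rfl; exact h.elim (fun h => h.1.ne rfl) fun h => h.2.ne rfl

theorem IsBetween.ne_right (h : IsBetween π x z y) : z ≠ y := (isBetween_comm.1 h).ne_left

theorem isBetween_iff_isBetween_comm {p q : V} (hps : p ≠ s) (hpt : p ≠ t) (hqs : q ≠ s)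
    (hqt : q ≠ t) (hst : s ≠ t) (hpq : p ≠ q) :
    (IsBetween π s p t ↔ IsBetween π s q t) ↔ (IsBetween π p s q ↔ IsBetween π p t q) := by
  have := π.injective.ne hps
  have := π.injective.ne hpt
  have := π.injective.ne hqs
  have := π.injective.ne hqt
  have := π.injective.ne hst
  have := π.injective.ne hpq
  simp only [IsBetween]
  grind

open scoped Classical in
theorem abs_pos_sub_pos (π : Arrangement V) (hxy : x ≠ y) :
    |(pos π x : ℝ) - pos π y| = 1 + ∑ z, if IsBetween π x z y then 1 else 0 := by
  wlog h : π x < π y generalizing x y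
  · rw [abs_sub_comm, this hxy.symm ((π.injective.ne hxy.symm).lt_of_le (not_lt.1 h))]
    simp only [isBetween_comm]
  have hbetween : ({z | IsBetween π x z y} : Finset V).map π.toEmbedding = Ioo (π x) (π y) := by
    ext i
    simp only [mem_map_equiv, mem_Ioo, IsBetween]
    grind
  rw [sum_boole, ← card_map π.toEmbedding, hbetween, Fin.card_Ioo, Nat.sub_sub,
    Nat.cast_sub (Fin.lt_def.1 h), abs_sub_comm, abs_of_nonneg]
  · simp only [pos]
    push_cast
    ring
  · simpa [pos] using h.le

theorem isCovered_iff : IsCovered G r π ↔ ∃ s t, G.Adj s t ∧ IsBetween π s r t := by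
  constructor
  · rintro ⟨s, t, hst, hs, ht⟩
    exact ⟨s, t, hst, .inl ⟨by simpa [pos] using hs, by simpa [pos] using ht⟩⟩
  · rintro ⟨s, t, hst, h | h⟩
    · exact ⟨s, t, hst, by simpa [pos] using h⟩
    · exact ⟨t, s, hst.symm, by simpa [pos] using h⟩

theorem isPlanar_iff : IsPlanar G π ↔ ∀ ⦃s t p q⦄, G.Adj s t → G.Adj p q →
    p ≠ s → p ≠ t → q ≠ s → q ≠ t → (IsBetween π s p t ↔ IsBetween π s q t) := by
  simp only [IsPlanar, pos, add_lt_add_iff_right, Fin.val_fin_lt]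
  constructor
  · intro h
    have himp : ∀ ⦃s t p q⦄, G.Adj s t → G.Adj p q → q ≠ s → q ≠ t →
        IsBetween π s p t → IsBetween π s q t := by
      intro s t p q hst hpq hqs hqt
      have := h s t p q hst hpq
      have := h q p s t hpq.symm hst
      have := h t s p q hst.symm hpq
      have := h q p t s hpq.symm hst.symm
      have := π.injective.ne hqs
      have := π.injective.ne hqt
      simp only [IsBetween]
      grind
    exact fun s t p q hst hpq hps hpt hqs hqt =>
      ⟨himp hst hpq hqs hqt, himp hst hpq.symm hps hpt⟩
  · rintro h s t p q hst hpq ⟨hsp, hpt, htq⟩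
    have hsq := hsp.trans (hpt.trans htq)
    have := (h hst hpq (ne_of_apply_ne π hsp.ne') (ne_of_apply_ne π hpt.ne)
      (ne_of_apply_ne π hsq.ne') (ne_of_apply_ne π htq.ne')).1 (.inl ⟨hsp, hpt⟩)
    exact this.elim (fun h => h.2.not_gt htq) fun h => h.2.not_gt hsq

theorem mem_planarArrangements : π ∈ planarArrangements G ↔ IsPlanar G π := by
  simp [planarArrangements]

theorem mem_projectiveArrangements : π ∈ projectiveArrangements G r ↔ IsProjective G r π := by
  simp [projectiveArrangements]

theorem mem_projectiveArrangementsFixed :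
    π ∈ projectiveArrangementsFixed G r ↔ IsPlanar G π ∧ (π r : ℕ) = 0 := by
  have hfirst : (π r : ℕ) = 0 → ¬ IsCovered G r π := by
    rintro h ⟨s, -, -, hs, -⟩
    simp [pos, h] at hs
  simp only [projectiveArrangementsFixed, mem_filter, mem_projectiveArrangements, IsProjective,
    pos, Nat.add_eq_right]
  tauto

end Arrangement

section Existence

variable {V : Type*} [Fintype V] {G : SimpleGraph V}

/-- The leaf is inserted immediately after its neighbour. -/
theorem exists_isPlanar_of_induce_compl_leaf {l p : V} (hp : G.Adj l p)
    (hl : ∀ x, G.Adj l x → x = p) [Fintype ({l}ᶜ : Set V)] {π : Arrangement ({l}ᶜ : Set V)}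
    (hπ : IsPlanar (G.induce {l}ᶜ) π) : ∃ ρ : Arrangement V, IsPlanar G ρ := by
  classical
  let key : V → ℕ := fun x => if h : x = l then 2 * π ⟨p, hp.ne'⟩ + 1 else 2 * π ⟨x, h⟩
  have hkey {x : V} (h : x ≠ l) : key x = 2 * π ⟨x, h⟩ := dif_neg h
  have hkeyl : key l = key p + 1 := by rw [hkey hp.ne']; exact dif_pos rfl
  have hinj : Function.Injective key := by
    intro x y hxy
    have := hkey hp.ne'
    by_cases hx : x = l <;> by_cases hy : y = l
    · rw [hx, hy]
    · subst hx; have := hkey hy; omega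
    · subst hy; have := hkey hx; omega
    · rw [hkey hx, hkey hy] at hxy
      exact congrArg Subtype.val (π.injective (Fin.ext (by omega : (π ⟨x, hx⟩ : ℕ) = π ⟨y, hy⟩)))
  refine ⟨ofKey key hinj, fun s t u v hst huv => ?_⟩
  simp only [pos, add_lt_add_iff_right, Fin.val_fin_lt, ofKey_lt_ofKey_iff]
  rintro ⟨hsu, hut, htv⟩
  have hs : s ≠ l := by rintro rfl; rw [hl t hst] at hut; omega
  have ht : t ≠ l := by rintro rfl; rw [hl s hst.symm] at hsu; omega
  have hu : u ≠ l := by rintro rfl; rw [hl v huv] at htv; omega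
  have hv : v ≠ l := by rintro rfl; rw [hl u huv.symm] at hut; omega
  rw [hkey hs, hkey hu] at hsu
  rw [hkey hu, hkey ht] at hut
  rw [hkey ht, hkey hv] at htv
  exact hπ ⟨s, hs⟩ ⟨t, ht⟩ ⟨u, hu⟩ ⟨v, hv⟩ hst huv
    ⟨by simp only [pos]; omega, by simp only [pos]; omega, by simp only [pos]; omega⟩

theorem exists_isPlanar_of_isTree (hG : G.IsTree) : ∃ π : Arrangement V, IsPlanar G π := by
  classical
  induction hn : Fintype.card V using Nat.strong_induction_on generalizing V with
  | h n ih =>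
    rcases subsingleton_or_nontrivial V with hV | hV
    · exact ⟨Fintype.equivFin V, fun s t _ _ hst => absurd (Subsingleton.elim s t) hst.ne⟩
    obtain ⟨l, hl⟩ := hG.exists_vert_degree_one_of_nontrivial
    obtain ⟨p, hp, hpl⟩ := SimpleGraph.degree_eq_one_iff_existsUnique_adj.1 hl
    have htree : (G.induce {l}ᶜ).IsTree :=
      ⟨hG.connected.induce_compl_singleton_of_degree_eq_one hl, hG.isAcyclic.induce _⟩
    obtain ⟨π, hπ⟩ := ih _ (hn ▸ Fintype.card_subtype_lt (x := l) (by simp)) htree rfl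
    exact exists_isPlanar_of_induce_compl_leaf hp hpl hπ

end Existence

section Cyclic

variable {V : Type*} [Fintype V] {G : SimpleGraph V} {π : Arrangement V} {s t u v x z : V}

/-- The cyclic rotation of `π` that brings `v` to the first position. -/
def rotateTo (π : Arrangement V) (v : V) : Arrangement V :=
  haveI : NeZero (Fintype.card V) := ⟨(Fintype.card_pos_iff.2 ⟨v⟩).ne'⟩
  π.trans (Equiv.subRight (π v))

/-- The reversal of the cyclic order of `π` that brings `v` to the first position. -/
def reflectTo (π : Arrangement V) (v : V) : Arrangement V :=
  haveI : NeZero (Fintype.card V) := ⟨(Fintype.card_pos_iff.2 ⟨v⟩).ne'⟩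
  π.trans (Equiv.subLeft (π v))

theorem val_rotateTo (π : Arrangement V) (v x : V) : (rotateTo π v x : ℕ) =
    if π x < π v then Fintype.card V + π x - π v else (π x : ℕ) - π v := by
  have : NeZero (Fintype.card V) := ⟨(Fintype.card_pos_iff.2 ⟨v⟩).ne'⟩
  split_ifs with h
  · exact Fin.coe_sub_iff_lt.2 h
  · exact Fin.coe_sub_iff_le.2 (not_lt.1 h)

theorem val_reflectTo (π : Arrangement V) (v x : V) : (reflectTo π v x : ℕ) =
    if π v < π x then Fintype.card V + π v - π x else (π v : ℕ) - π x := by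
  have : NeZero (Fintype.card V) := ⟨(Fintype.card_pos_iff.2 ⟨v⟩).ne'⟩
  split_ifs with h
  · exact Fin.coe_sub_iff_lt.2 h
  · exact Fin.coe_sub_iff_le.2 (not_lt.1 h)

theorem rotateTo_rotateTo (h : (π u : ℕ) = 0) : rotateTo (rotateTo π v) u = π := by
  ext x
  simp only [val_rotateTo, Fin.lt_def, h]
  split_ifs <;> omega

theorem reflectTo_reflectTo (h : (π u : ℕ) = 0) : reflectTo (reflectTo π u) u = π := by
  ext x
  simp only [val_reflectTo, Fin.lt_def, h]
  split_ifs <;> omega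

theorem isBetween_rotateTo (hs : z ≠ s) (ht : z ≠ t) : IsBetween (rotateTo π v) s z t ↔
    (IsBetween π s z t ↔ (π s < π v ↔ π t < π v)) := by
  have := Fin.val_ne_of_ne (π.injective.ne hs)
  have := Fin.val_ne_of_ne (π.injective.ne ht)
  simp only [IsBetween, Fin.lt_def, val_rotateTo]
  split_ifs <;> omega

theorem isBetween_reflectTo (hs : z ≠ s) (ht : z ≠ t) : IsBetween (reflectTo π v) s z t ↔
    (IsBetween π s z t ↔ (π v < π s ↔ π v < π t)) := by
  have := Fin.val_ne_of_ne (π.injective.ne hs)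
  have := Fin.val_ne_of_ne (π.injective.ne ht)
  simp only [IsBetween, Fin.lt_def, val_reflectTo]
  split_ifs <;> omega

theorem IsPlanar.rotateTo (h : IsPlanar G π) (v : V) : IsPlanar G (rotateTo π v) :=
  isPlanar_iff.2 fun s t p q hst hpq hps hpt hqs hqt => by
    rw [isBetween_rotateTo hps hpt, isBetween_rotateTo hqs hqt,
      isPlanar_iff.1 h hst hpq hps hpt hqs hqt]

theorem IsPlanar.reflectTo (h : IsPlanar G π) (v : V) : IsPlanar G (reflectTo π v) :=
  isPlanar_iff.2 fun s t p q hst hpq hps hpt hqs hqt => by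
    rw [isBetween_reflectTo hps hpt, isBetween_reflectTo hqs hqt,
      isPlanar_iff.1 h hst hpq hps hpt hqs hqt]

theorem IsPlanar.rotateTo_mem (h : IsPlanar G π) (v : V) :
    LinArr.rotateTo π v ∈ projectiveArrangementsFixed G v :=
  mem_projectiveArrangementsFixed.2 ⟨h.rotateTo v, by simp [val_rotateTo]⟩

theorem IsPlanar.reflectTo_mem (h : IsPlanar G π) (v : V) :
    LinArr.reflectTo π v ∈ projectiveArrangementsFixed G v :=
  mem_projectiveArrangementsFixed.2 ⟨h.reflectTo v, by simp [val_reflectTo]⟩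

theorem card_projectiveArrangementsFixed_eq (G : SimpleGraph V) (u v : V) :
    #(projectiveArrangementsFixed G u) = #(projectiveArrangementsFixed G v) := by
  refine card_nbij' (rotateTo · v) (rotateTo · u) ?_ ?_ ?_ ?_ <;> intro π hπ <;>
    have ⟨hplanar, hfirst⟩ := mem_projectiveArrangementsFixed.1 hπ
  · exact hplanar.rotateTo_mem v
  · exact hplanar.rotateTo_mem u
  · exact rotateTo_rotateTo hfirst
  · exact rotateTo_rotateTo hfirst

theorem sum_planarArrangements [Nonempty V] (G : SimpleGraph V) (F : Arrangement V → ℝ) :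
    ∑ π ∈ planarArrangements G, F π = ∑ u, ∑ π ∈ projectiveArrangementsFixed G u, F π := by
  classical
  rw [← sum_fiberwise _ first]
  refine sum_congr rfl fun u _ => sum_congr ?_ fun _ _ => rfl
  ext π
  rw [mem_filter, mem_planarArrangements, mem_projectiveArrangementsFixed, first_eq_iff]

theorem expPlanar_eq_average [Nonempty V] (G : SimpleGraph V) :
    expPlanar G = 1 / (Fintype.card V : ℝ) * ∑ u : V, expProjectiveFixed G u := by
  obtain ⟨r⟩ := ‹Nonempty V›
  have hcard (u : V) := card_projectiveArrangementsFixed_eq G u r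
  have htotal : (#(planarArrangements G) : ℝ) =
      Fintype.card V * #(projectiveArrangementsFixed G r) := by
    simpa [hcard] using sum_planarArrangements G fun _ => 1
  simp only [expPlanar, expProjectiveFixed, expect_eq_sum_div_card, hcard, htotal,
    sum_planarArrangements, ← sum_div]
  rw [div_mul_div_comm, one_mul]

theorem dist_add_dist_reflectTo (hu : (π u : ℕ) = 0) (huv : u ≠ v) :
    |(pos π u : ℝ) - pos π v| + |(pos (reflectTo π u) u : ℝ) - pos (reflectTo π u) v| =
      Fintype.card V := by
  have hv : 0 < (π v : ℕ) := by
    rw [Nat.pos_iff_ne_zero, ← hu]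
    exact Fin.val_ne_of_ne (π.injective.ne huv.symm)
  have hlt : (π v : ℕ) ≤ Fintype.card V := (π v).isLt.le
  simp only [pos, val_reflectTo, Fin.lt_def, hu, hv, if_true, lt_irrefl, if_false, add_zero]
  push_cast [Nat.cast_sub hlt]
  rw [abs_sub_comm, abs_of_nonneg (by simp), abs_sub_comm, abs_of_nonneg (by simp)]
  ring

open scoped BigOperators in
/-- The reflection fixing the root pairs the distances `d` and `n - d`. -/
theorem expect_dist_root_fixed (hne : (projectiveArrangementsFixed G u).Nonempty) (huv : u ≠ v) :
    𝔼 π ∈ projectiveArrangementsFixed G u, |(pos π u : ℝ) - pos π v| =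
      (Fintype.card V : ℝ) / 2 := by
  have hmem : ∀ π ∈ projectiveArrangementsFixed G u,
      reflectTo π u ∈ projectiveArrangementsFixed G u :=
    fun π hπ => (mem_projectiveArrangementsFixed.1 hπ).1.reflectTo_mem u
  have hinv : ∀ π ∈ projectiveArrangementsFixed G u, reflectTo (reflectTo π u) u = π :=
    fun π hπ => reflectTo_reflectTo (mem_projectiveArrangementsFixed.1 hπ).2
  have hreflect : 𝔼 π ∈ projectiveArrangementsFixed G u,
        |(pos (reflectTo π u) u : ℝ) - pos (reflectTo π u) v| =
      𝔼 π ∈ projectiveArrangementsFixed G u, |(pos π u : ℝ) - pos π v| :=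
    expect_nbij' (reflectTo · u) (reflectTo · u) hmem hmem hinv hinv fun _ _ => rfl
  have hsum : 𝔼 π ∈ projectiveArrangementsFixed G u, (|(pos π u : ℝ) - pos π v| +
      |(pos (reflectTo π u) u : ℝ) - pos (reflectTo π u) v|) = Fintype.card V := by
    rw [expect_congr rfl fun π hπ =>
      dist_add_dist_reflectTo (mem_projectiveArrangementsFixed.1 hπ).2 huv, expect_const hne]
  rw [expect_add_distrib, hreflect] at hsum
  linarith

end Cyclic

section Blocks

variable {V β : Type*} [Fintype V] {b : V → β} {π : Arrangement V} {σ : Equiv.Perm β}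
  {x x' y y' z z' : V}

/-- Every block, that is, every fibre of `b`, occupies an interval of positions in `π`. -/
def BlocksContiguous (b : V → β) (π : Arrangement V) : Prop :=
  ∀ ⦃x y z⦄, b x = b y → IsBetween π x z y → b z = b x

theorem BlocksContiguous.lt_iff_lt (hπ : BlocksContiguous b π) (hx : b x = b x')
    (hy : b y = b y') (hne : b x ≠ b y) : π x < π y ↔ π x' < π y' := by
  have hx₁ := @hπ x x' y hx
  have hy₁ := @hπ y y' x' hy
  have := π.injective.ne (ne_of_apply_ne b hne)
  have := π.injective.ne (ne_of_apply_ne b (hx ▸ hne))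
  have := π.injective.ne (ne_of_apply_ne b (hx ▸ hy ▸ hne))
  simp only [IsBetween] at hx₁ hy₁
  grind

/-- The arrangement in which the blocks of `b` are permuted, the block `c` taking the place of the
block `σ c` in the order of the blocks, while the order inside each block is kept. The place of a
block is read off an arbitrary element, which is meaningful when `BlocksContiguous b π`. -/
noncomputable def permuteBlocks (hb : Function.Surjective b) (σ : Equiv.Perm β)
    (π : Arrangement V) : Arrangement V :=
  ofKey (fun x => toLex (π (Function.surjInv hb (σ (b x))), π x))
    fun _ _ h => π.injective (congrArg (fun p => (ofLex p).2) h)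

variable {hb : Function.Surjective b}

theorem permuteBlocks_lt_iff : permuteBlocks hb σ π x < permuteBlocks hb σ π y ↔
    π (Function.surjInv hb (σ (b x))) < π (Function.surjInv hb (σ (b y))) ∨
      b x = b y ∧ π x < π y := by
  refine (ofKey_lt_ofKey_iff _).trans (Prod.Lex.lt_iff.trans ?_)
  simp [(Function.injective_surjInv hb).eq_iff]

theorem permuteBlocks_lt_iff_of_eq (h : b x = b y) :
    permuteBlocks hb σ π x < permuteBlocks hb σ π y ↔ π x < π y := by
  simp [permuteBlocks_lt_iff, h]

theorem permuteBlocks_lt_iff_of_ne (hπ : BlocksContiguous b π) (h : b x ≠ b y)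
    (hx : b x' = σ (b x)) (hy : b y' = σ (b y)) :
    permuteBlocks hb σ π x < permuteBlocks hb σ π y ↔ π x' < π y' := by
  rw [permuteBlocks_lt_iff, or_iff_left fun h' => h h'.1]
  have hinv := Function.surjInv_eq hb
  exact hπ.lt_iff_lt ((hinv _).trans hx.symm) ((hinv _).trans hy.symm)
    (by rw [hinv, hinv]; exact σ.injective.ne h)

theorem blocksContiguous_permuteBlocks (hb : Function.Surjective b) (σ : Equiv.Perm β)
    (π : Arrangement V) : BlocksContiguous b (permuteBlocks hb σ π) := by
  intro x y z hxy h
  simp only [IsBetween, permuteBlocks_lt_iff, hxy] at h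
  grind

theorem permuteBlocks_symm_permuteBlocks (hπ : BlocksContiguous b π) :
    permuteBlocks hb σ.symm (permuteBlocks hb σ π) = π := by
  refine eq_of_lt_iff_lt fun x y => ?_
  by_cases h : b x = b y
  · rw [permuteBlocks_lt_iff_of_eq h, permuteBlocks_lt_iff_of_eq h]
  obtain ⟨x', hx'⟩ := hb (σ.symm (b x))
  obtain ⟨y', hy'⟩ := hb (σ.symm (b y))
  rw [permuteBlocks_lt_iff_of_ne (blocksContiguous_permuteBlocks hb σ π) h hx' hy',
    permuteBlocks_lt_iff_of_ne hπ (by rw [hx', hy']; exact σ.symm.injective.ne h)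
      (σ.symm_apply_eq.1 hx'.symm) (σ.symm_apply_eq.1 hy'.symm)]

theorem apply_first_permuteBlocks [Nonempty V] (hπ : BlocksContiguous b π) :
    σ (b (first (permuteBlocks hb σ π))) = b (first π) := by
  by_contra hne
  obtain ⟨x, hx⟩ := hb (σ.symm (b (first π)))
  obtain ⟨y, hy⟩ := hb (σ (b (first (permuteBlocks hb σ π))))
  have hσx : σ (b x) = b (first π) := by rw [hx, Equiv.apply_symm_apply]
  have hlt : ¬ π (first π) < π y := by
    rw [← permuteBlocks_lt_iff_of_ne (hb := hb) hπ (fun h => hne (h ▸ hσx)) hσx.symm hy]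
    exact not_lt_first
  have heq : first π = y := π.injective (le_antisymm (not_lt.1 not_lt_first) (not_lt.1 hlt))
  exact hne (by rw [heq, hy])

theorem isBetween_permuteBlocks_of_eq (hπ : BlocksContiguous b π) (h : b x = b y) :
    IsBetween (permuteBlocks hb σ π) x z y ↔ IsBetween π x z y := by
  by_cases hz : b z = b x
  · simp only [IsBetween, permuteBlocks_lt_iff_of_eq, hz, h]
  · exact iff_of_false (fun h' => hz (blocksContiguous_permuteBlocks hb σ π h h'))
      fun h' => hz (hπ h h')

theorem isBetween_permuteBlocks_of_ne (hπ : BlocksContiguous b π) (hxz : b x ≠ b z)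
    (hyz : b y ≠ b z) (hx : b x' = σ (b x)) (hy : b y' = σ (b y)) (hz : b z' = σ (b z)) :
    IsBetween (permuteBlocks hb σ π) x z y ↔ IsBetween π x' z' y' := by
  simp only [IsBetween, permuteBlocks_lt_iff_of_ne hπ hxz hx hz,
    permuteBlocks_lt_iff_of_ne hπ hyz hy hz, permuteBlocks_lt_iff_of_ne hπ hxz.symm hz hx,
    permuteBlocks_lt_iff_of_ne hπ hyz.symm hz hy]

theorem sumEdgeLengths_permuteBlocks {H : SimpleGraph V} (hH : ∀ ⦃s t⦄, H.Adj s t → b s = b t)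
    (hπ : BlocksContiguous b π) :
    sumEdgeLengths H (permuteBlocks hb σ π) = sumEdgeLengths H π := by
  classical
  refine sum_congr rfl fun e he => ?_
  induction e with
  | h s t =>
    have hst : H.Adj s t := SimpleGraph.mem_edgeFinset.1 he
    simp only [edgeLength, Sym2.lift_mk, abs_pos_sub_pos _ hst.ne,
      isBetween_permuteBlocks_of_eq hπ (hH hst)]

/-- A set of arrangements with contiguous blocks that is stable under all permutations of the
blocks, so that the blocks of its uniformly random element are in uniformly random order. -/
def BlockSymmetric (hb : Function.Surjective b) (S : Finset (Arrangement V)) : Prop :=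
  ∀ π ∈ S, BlocksContiguous b π ∧ ∀ σ, permuteBlocks hb σ π ∈ S

namespace BlockSymmetric

variable {S : Finset (Arrangement V)} {c : β} {u v : V}

open scoped BigOperators in
theorem expect_permuteBlocks (hS : BlockSymmetric hb S) (σ : Equiv.Perm β)
    (F : Arrangement V → ℝ) : 𝔼 π ∈ S, F (permuteBlocks hb σ π) = 𝔼 π ∈ S, F π :=
  expect_nbij' (permuteBlocks hb σ) (permuteBlocks hb σ.symm) (fun π hπ => (hS π hπ).2 _)
    (fun π hπ => (hS π hπ).2 _) (fun π hπ => permuteBlocks_symm_permuteBlocks (hS π hπ).1)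
    (fun π hπ => permuteBlocks_symm_permuteBlocks (σ := σ.symm) (hS π hπ).1)
    fun _ _ => rfl

open scoped Classical in
theorem sum_filter_first [Nonempty V] (hS : BlockSymmetric hb S) {F : Arrangement V → ℝ}
    (hF : ∀ π ∈ S, ∀ σ, F (permuteBlocks hb σ π) = F π) (c d : β) :
    ∑ π ∈ S with b (first π) = c, F π = ∑ π ∈ S with b (first π) = d, F π := by
  have hmem (e f : β) : ∀ π ∈ ({π ∈ S | b (first π) = e} : Finset (Arrangement V)),
      permuteBlocks hb (Equiv.swap e f) π ∈ ({π ∈ S | b (first π) = f} : Finset _) := by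
    intro π hπ
    obtain ⟨hπS, rfl⟩ := mem_filter.1 hπ
    refine mem_filter.2 ⟨(hS π hπS).2 _, (Equiv.swap (b (first π)) f).injective ?_⟩
    rw [apply_first_permuteBlocks (hS π hπS).1, Equiv.swap_apply_right]
  have hinv (e f : β) : ∀ π ∈ S,
      permuteBlocks hb (Equiv.swap f e) (permuteBlocks hb (Equiv.swap e f) π) = π := by
    intro π hπ
    rw [Equiv.swap_comm f e]
    simpa using permuteBlocks_symm_permuteBlocks (σ := Equiv.swap e f) (hb := hb) (hS π hπ).1
  exact sum_nbij' _ _ (hmem c d) (hmem d c) (fun π hπ => hinv c d π (filter_subset _ _ hπ))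
    (fun π hπ => hinv d c π (filter_subset _ _ hπ))
    fun π hπ => (hF π (filter_subset _ _ hπ) _).symm

open scoped Classical BigOperators in
theorem expect_filter_first [Nonempty V] (hS : BlockSymmetric hb S) {F : Arrangement V → ℝ}
    (hF : ∀ π ∈ S, ∀ σ, F (permuteBlocks hb σ π) = F π) (c : β) :
    𝔼 π ∈ S with b (first π) = c, F π = 𝔼 π ∈ S, F π := by
  have := Fintype.ofSurjective b hb
  have hsum {F : Arrangement V → ℝ} (hF : ∀ π ∈ S, ∀ σ, F (permuteBlocks hb σ π) = F π) :
      ∑ π ∈ S, F π = Fintype.card β * ∑ π ∈ S with b (first π) = c, F π := by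
    rw [← sum_fiberwise S fun π => b (first π),
      sum_congr rfl fun d _ => hS.sum_filter_first hF d c, sum_const, card_univ, nsmul_eq_mul]
  have hcard : (#S : ℝ) = Fintype.card β * #{π ∈ S | b (first π) = c} := by
    simpa using hsum (F := fun _ => 1) fun _ _ _ => rfl
  have hβ : (Fintype.card β : ℝ) ≠ 0 := Nat.cast_ne_zero.2 (Fintype.card_pos_iff.2 ⟨c⟩).ne'
  rw [expect_eq_sum_div_card, expect_eq_sum_div_card, hsum hF, hcard, mul_div_mul_left _ _ hβ]

open scoped Classical BigOperators in
/-- Exchanging the blocks of `u` and `v` negates the event that `x` lies between `u` and `v`. -/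
theorem expect_isBetween_of_eq (hS : BlockSymmetric hb S) (hne : S.Nonempty) (huv : b u ≠ b v)
    (hx : b x = b v) (hxv : x ≠ v) :
    𝔼 π ∈ S, (if IsBetween π u x v then 1 else 0 : ℝ) = 1 / 2 := by
  have hcompl : ∀ π ∈ S, (if IsBetween (permuteBlocks hb (Equiv.swap (b u) (b v)) π) u x v
      then 1 else 0 : ℝ) + (if IsBetween π u x v then 1 else 0) = 1 := by
    intro π hπ
    have hux : b u ≠ b x := hx ▸ huv
    have hu' : b x = Equiv.swap (b u) (b v) (b u) := by rw [Equiv.swap_apply_left, hx]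
    have hx' : b u = Equiv.swap (b u) (b v) (b x) := by rw [hx, Equiv.swap_apply_right]
    have := π.injective.ne hxv
    have := π.injective.ne (ne_of_apply_ne b hux)
    simp only [IsBetween, permuteBlocks_lt_iff_of_ne (hS π hπ).1 hux hu' hx',
      permuteBlocks_lt_iff_of_ne (hS π hπ).1 hux.symm hx' hu', permuteBlocks_lt_iff_of_eq hx,
      permuteBlocks_lt_iff_of_eq hx.symm]
    grind
  have hsum := expect_congr rfl hcompl
  rw [expect_add_distrib, expect_const hne,
    hS.expect_permuteBlocks _ fun π => if IsBetween π u x v then (1 : ℝ) else 0] at hsum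
  linarith

open scoped Classical BigOperators in
/-- Each of the three blocks is equally likely to be the middle one. -/
theorem expect_isBetween_of_ne (hS : BlockSymmetric hb S) (hne : S.Nonempty) (hux : b u ≠ b x)
    (hvx : b v ≠ b x) (huv : b u ≠ b v) :
    𝔼 π ∈ S, (if IsBetween π u x v then 1 else 0 : ℝ) = 1 / 3 := by
  have hswap₁ : 𝔼 π ∈ S, (if IsBetween π x u v then 1 else 0 : ℝ) =
      𝔼 π ∈ S, if IsBetween π u x v then 1 else 0 := by
    rw [← hS.expect_permuteBlocks (Equiv.swap (b u) (b x))]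
    refine expect_congr rfl fun π hπ => ?_
    rw [isBetween_permuteBlocks_of_ne (hS π hπ).1 hux.symm huv.symm
      (Equiv.swap_apply_right _ _).symm (Equiv.swap_apply_of_ne_of_ne huv.symm hvx).symm
      (Equiv.swap_apply_left _ _).symm]
  have hswap₂ : 𝔼 π ∈ S, (if IsBetween π u v x then 1 else 0 : ℝ) =
      𝔼 π ∈ S, if IsBetween π u x v then 1 else 0 := by
    rw [← hS.expect_permuteBlocks (Equiv.swap (b v) (b x))]
    refine expect_congr rfl fun π hπ => ?_
    rw [isBetween_permuteBlocks_of_ne (hS π hπ).1 huv hvx.symm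
      (Equiv.swap_apply_of_ne_of_ne huv hux).symm (Equiv.swap_apply_right _ _).symm
      (Equiv.swap_apply_left _ _).symm]
  have hone : ∀ π ∈ S, (if IsBetween π u x v then 1 else 0 : ℝ) +
      (if IsBetween π x u v then 1 else 0) + (if IsBetween π u v x then 1 else 0) = 1 := by
    intro π _
    have := π.injective.ne (ne_of_apply_ne b hux)
    have := π.injective.ne (ne_of_apply_ne b hvx)
    have := π.injective.ne (ne_of_apply_ne b huv)
    simp only [IsBetween]
    grind
  have hsum := expect_congr rfl hone
  rw [expect_add_distrib, expect_add_distrib, hswap₁, hswap₂, expect_const hne] at hsum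
  linarith

open scoped Classical BigOperators in
theorem expect_dist (hS : BlockSymmetric hb S) (hne : S.Nonempty) (hu : ∀ x, b x = b u ↔ x = u)
    (hvu : v ≠ u) : 𝔼 π ∈ S, |(pos π u : ℝ) - pos π v| =
      (Fintype.card V : ℝ) / 2 - (Fintype.card V - 1 - #{x | b x = b v}) / 6 := by
  have huv : b u ≠ b v := fun h => hvu ((hu v).1 h.symm)
  have hbetween (x : V) : 𝔼 π ∈ S, (if IsBetween π u x v then 1 else 0 : ℝ) =
      1 / 3 + (if b x = b v then 1 else 0) / 6 - (if x = u then 1 else 0) / 3 -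
        (if x = v then 1 else 0) / 2 := by
    by_cases hxu : x = u
    · subst hxu
      rw [if_neg huv, if_pos rfl, if_neg hvu.symm, expect_eq_zero fun π _ =>
        if_neg fun h => h.ne_left rfl]
      norm_num
    by_cases hxv : x = v
    · subst hxv
      rw [if_pos rfl, if_neg hxu, if_pos rfl, expect_eq_zero fun π _ =>
        if_neg fun h => h.ne_right rfl]
      norm_num
    have hux : b u ≠ b x := fun h => hxu ((hu x).1 h.symm)
    by_cases hx : b x = b v
    · rw [hS.expect_isBetween_of_eq hne huv hx hxv, if_pos hx, if_neg hxu, if_neg hxv]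
      norm_num
    · rw [hS.expect_isBetween_of_ne hne hux (Ne.symm hx) huv, if_neg hx, if_neg hxu, if_neg hxv]
      norm_num
  have hone (w : V) : ∑ x, (if x = w then 1 else 0 : ℝ) = 1 := by simp
  simp only [abs_pos_sub_pos _ hvu.symm]
  rw [expect_add_distrib, expect_const hne, expect_sum_comm, sum_congr rfl fun x _ => hbetween x]
  simp only [sum_sub_distrib, sum_add_distrib, sum_const, card_univ, ← sum_div, hone, sum_boole,
    nsmul_eq_mul]
  ring

end BlockSymmetric

end Blocks

section Branch

variable {V : Type*} {G : SimpleGraph V} {u v x y : V}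

theorem exists_adj_of_connectedComponentMk_eq {H : SimpleGraph V} {P : V → Prop}
    (h : H.connectedComponentMk x = H.connectedComponentMk y) (hx : P x) (hy : ¬ P y) :
    ∃ s t, H.Adj s t ∧ H.connectedComponentMk s = H.connectedComponentMk x ∧ P s ∧ ¬ P t := by
  obtain ⟨p⟩ := SimpleGraph.ConnectedComponent.exact h
  obtain ⟨d, -, ⟨hds, hdP⟩, hdt⟩ := p.exists_boundary_dart
    {z | H.connectedComponentMk z = H.connectedComponentMk x ∧ P z} ⟨rfl, hx⟩ fun h => hy h.2
  have hst := SimpleGraph.ConnectedComponent.connectedComponentMk_eq_of_adj d.adj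
  exact ⟨d.fst, d.snd, d.adj, hds, hdP, fun ht => hdt ⟨hst.symm.trans hds, ht⟩⟩

/-- The branch of `x` in `G` rooted at `u`: the component of `x` after the edges at `u` have been
deleted. The root is kept as a vertex, so that `{u}` is a branch as well. -/
def branch (G : SimpleGraph V) (u x : V) : (G.deleteIncidenceSet u).ConnectedComponent :=
  (G.deleteIncidenceSet u).connectedComponentMk x

theorem branch_surjective (G : SimpleGraph V) (u : V) : Function.Surjective (branch G u) :=
  Quot.mk_surjective

theorem branch_eq_of_adj (h : G.Adj x y) (hx : x ≠ u) (hy : y ≠ u) : branch G u x = branch G u y :=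
  SimpleGraph.ConnectedComponent.connectedComponentMk_eq_of_adj
    (SimpleGraph.deleteIncidenceSet_adj.2 ⟨h, hx, hy⟩)

theorem exists_adj_of_branch_eq {P : V → Prop} (h : branch G u x = branch G u y) (hx : P x)
    (hy : ¬ P y) :
    ∃ s t, G.Adj s t ∧ s ≠ u ∧ t ≠ u ∧ branch G u s = branch G u x ∧ P s ∧ ¬ P t := by
  obtain ⟨s, t, hst, hs⟩ := exists_adj_of_connectedComponentMk_eq h hx hy
  obtain ⟨hG, hsu, htu⟩ := SimpleGraph.deleteIncidenceSet_adj.1 hst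
  exact ⟨s, t, hG, hsu, htu, hs⟩

theorem branch_eq_branch_root_iff : branch G u x = branch G u u ↔ x = u := by
  refine ⟨fun h => by_contra fun hx => ?_, fun h => h ▸ rfl⟩
  obtain ⟨s, t, -, -, ht, -, -, htu⟩ := exists_adj_of_branch_eq (P := (· ≠ u)) h hx (not_not.2 rfl)
  exact htu ht

theorem exists_adj_root_branch_eq (hG : G.Connected) (hx : x ≠ u) :
    ∃ v, G.Adj u v ∧ branch G u v = branch G u x := by
  obtain ⟨p⟩ := hG x u
  obtain ⟨d, -, hfst, hsnd⟩ := p.exists_boundary_dart {z | branch G u z = branch G u x} rfl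
    fun h => hx (branch_eq_branch_root_iff.1 h.symm)
  have hne : d.fst ≠ u := fun h => hx (branch_eq_branch_root_iff.1 (h ▸ hfst.symm))
  have hroot : d.snd = u := by_contra fun h => hsnd ((branch_eq_of_adj d.adj hne h).symm.trans hfst)
  exact ⟨d.fst, hroot ▸ d.adj.symm, hfst⟩

theorem eq_of_adj_root_of_branch_eq (hG : G.IsAcyclic) (hx : G.Adj u x) (hy : G.Adj u y)
    (h : branch G u x = branch G u y) : x = y := by
  by_contra hxy
  refine SimpleGraph.isBridge_iff.1 (SimpleGraph.isAcyclic_iff_forall_adj_isBridge.1 hG hx) ?_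
  have huy : (G.deleteEdges {s(u, x)}).Adj u y := by
    simp [SimpleGraph.deleteEdges_adj, hy, Ne.symm hxy, hx.ne]
  have hle : G.deleteIncidenceSet u ≤ G.deleteEdges {s(u, x)} :=
    SimpleGraph.deleteEdges_anti (Set.singleton_subset_iff.2 (G.mk'_mem_incidenceSet_left_iff.2 hx))
  exact huy.reachable.trans ((SimpleGraph.ConnectedComponent.exact h.symm).mono hle)

variable [Fintype V] {π : Arrangement V}

/-- An edge of the branch of `x` and `y` that covers `z` covers the whole branch of `z`, hence also
the neighbour of the root in that branch and the root itself. -/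
theorem IsProjective.blocksContiguous (hG : G.Connected) (hπ : IsProjective G u π) :
    BlocksContiguous (branch G u) π := by
  intro x y z hxy hz
  by_contra hne
  wlog hxz : π x < π z generalizing x y
  · exact this hxy.symm (isBetween_comm.1 hz) (hxy ▸ hne)
      (hz.elim (fun h => absurd h.1 hxz) fun h => h.1)
  have hzy : ¬ π y < π z := hz.elim (fun h => h.2.not_gt) fun h => absurd hxz h.2.not_gt
  obtain ⟨s, t, hst, hsu, htu, hsx, hsz, htz⟩ :=
    exists_adj_of_branch_eq (P := (π · < π z)) hxy hxz hzy
  have hbt : branch G u t = branch G u x := (branch_eq_of_adj hst hsu htu).symm.trans hsx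
  have hzt : z ≠ t := fun h => hne (h ▸ hbt)
  have hst_z : IsBetween π s z t := .inl ⟨hsz, (not_lt.1 htz).lt_of_ne (π.injective.ne hzt)⟩
  have hmem : ∀ w, branch G u w = branch G u z → IsBetween π s w t := by
    intro w hw
    by_contra hwst
    obtain ⟨p, q, hpq, hpu, hqu, hpz, hp, hq⟩ := exists_adj_of_branch_eq
      (P := (IsBetween π s · t)) hw.symm hst_z hwst
    have hqz : branch G u q = branch G u z := (branch_eq_of_adj hpq hpu hqu).symm.trans hpz
    exact hq ((isPlanar_iff.1 hπ.1 hst hpq hp.ne_left hp.ne_right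
      (fun h => hne (hqz ▸ h ▸ hsx)) fun h => hne (hqz ▸ h ▸ hbt)).1 hp)
  refine hπ.2 (isCovered_iff.2 ⟨s, t, hst, ?_⟩)
  by_cases hzu : z = u
  · exact hzu ▸ hst_z
  obtain ⟨v, huv, hvz⟩ := exists_adj_root_branch_eq hG hzu
  have hv := hmem v hvz
  exact (isPlanar_iff.1 hπ.1 hst huv.symm hv.ne_left hv.ne_right hsu.symm htu.symm).1 hv

theorem IsProjective.permuteBlocks (hπ : IsProjective G u π)
    (hcont : BlocksContiguous (branch G u) π)
    (σ : Equiv.Perm (G.deleteIncidenceSet u).ConnectedComponent) :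
    IsProjective G u (permuteBlocks (branch_surjective G u) σ π) := by
  set ρ := LinArr.permuteBlocks (branch_surjective G u) σ π
  have hρ {s t z : V} (hst : G.Adj s t) (hs : s ≠ u) (ht : t ≠ u) :
      IsBetween ρ s z t ↔ IsBetween π s z t :=
    isBetween_permuteBlocks_of_eq hcont (branch_eq_of_adj hst hs ht)
  refine ⟨isPlanar_iff.2 fun s t p q hst hpq hps hpt hqs hqt => ?_, fun hcov => hπ.2 ?_⟩
  · by_cases hu : s ≠ u ∧ t ≠ u
    · rw [hρ hst hu.1 hu.2, hρ hst hu.1 hu.2, isPlanar_iff.1 hπ.1 hst hpq hps hpt hqs hqt]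
    -- Otherwise `u` is an endpoint of `st`, and the roles of the two edges are exchanged.
    have hpu : p ≠ u := by grind
    have hqu : q ≠ u := by grind
    rw [isBetween_iff_isBetween_comm hps hpt hqs hqt hst.ne hpq.ne, hρ hpq hpu hqu,
      hρ hpq hpu hqu, isPlanar_iff.1 hπ.1 hpq hst hps.symm hqs.symm hpt.symm hqt.symm]
  · obtain ⟨s, t, hst, hbetween⟩ := isCovered_iff.1 hcov
    exact isCovered_iff.2
      ⟨s, t, hst, (hρ hst hbetween.ne_left.symm hbetween.ne_right.symm).1 hbetween⟩

theorem blockSymmetric_projectiveArrangements (hG : G.Connected) (u : V) :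
    BlockSymmetric (branch_surjective G u) (projectiveArrangements G u) := by
  intro π hπ
  rw [mem_projectiveArrangements] at hπ
  have hcont := hπ.blocksContiguous hG
  exact ⟨hcont, fun σ => mem_projectiveArrangements.2 (hπ.permuteBlocks hcont σ)⟩

open scoped Classical in
theorem filter_branch_first_projectiveArrangements [Nonempty V] (G : SimpleGraph V) (u : V) :
    {π ∈ projectiveArrangements G u | branch G u (first π) = branch G u u} =
      projectiveArrangementsFixed G u := by
  refine filter_congr fun π _ => ?_
  rw [branch_eq_branch_root_iff, first_eq_iff, pos, Nat.add_eq_right]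

end Branch

section Expectation

variable {V : Type*} [Fintype V] {G : SimpleGraph V}

theorem planarArrangements_nonempty (hG : G.IsTree) : (planarArrangements G).Nonempty :=
  let ⟨π, hπ⟩ := exists_isPlanar_of_isTree hG
  ⟨π, mem_planarArrangements.2 hπ⟩

theorem projectiveArrangementsFixed_nonempty (hG : G.IsTree) (u : V) :
    (projectiveArrangementsFixed G u).Nonempty :=
  let ⟨_, hπ⟩ := exists_isPlanar_of_isTree hG
  ⟨_, hπ.rotateTo_mem u⟩

theorem projectiveArrangements_nonempty (hG : G.IsTree) (u : V) :
    (projectiveArrangements G u).Nonempty :=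
  (projectiveArrangementsFixed_nonempty hG u).mono (filter_subset _ _)

open scoped Classical in
theorem sumEdgeLengths_eq_sum_neighborFinset_add (G : SimpleGraph V) (u : V) (π : Arrangement V) :
    sumEdgeLengths G π = ∑ v ∈ G.neighborFinset u, |(pos π u : ℝ) - pos π v| +
      sumEdgeLengths (G.deleteIncidenceSet u) π := by
  have hincident : {e ∈ G.edgeFinset | u ∈ e} = (G.neighborFinset u).image (s(u, ·)) := by
    ext e
    induction e with
    | h s t =>
      simp only [mem_filter, SimpleGraph.mem_edgeFinset, SimpleGraph.mem_edgeSet, Sym2.mem_iff,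
        mem_image, SimpleGraph.mem_neighborFinset, Sym2.eq_iff]
      grind [G.adj_comm]
  have hroot : ∑ e ∈ G.edgeFinset with u ∈ e, edgeLength π e =
      ∑ v ∈ G.neighborFinset u, |(pos π u : ℝ) - pos π v| := by
    rw [hincident, sum_image fun _ _ _ _ h => Sym2.congr_right.1 h]
    rfl
  have hrest : ∑ e ∈ G.edgeFinset with u ∉ e, edgeLength π e =
      sumEdgeLengths (G.deleteIncidenceSet u) π := by
    refine sum_congr ?_ fun _ _ => rfl
    ext e
    induction e with
    | h s t =>
      simp only [mem_filter, SimpleGraph.mem_edgeFinset, SimpleGraph.mem_edgeSet, Sym2.mem_iff,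
        SimpleGraph.deleteIncidenceSet_adj]
      grind
  rw [sumEdgeLengths, ← sum_filter_add_sum_filter_not _ (u ∈ ·), hroot, hrest]

open scoped Classical in
theorem expProjectiveFixed_eq_of_connected (hG : G.Connected) {u : V}
    (hne : (projectiveArrangementsFixed G u).Nonempty) :
    expProjectiveFixed G u = expProjective G u + ∑ v ∈ G.neighborFinset u,
      ((Fintype.card V : ℝ) - 1 - #{x | branch G u x = branch G u v}) / 6 := by
  have := hG.nonempty
  have hsymm := blockSymmetric_projectiveArrangements hG u
  have hinner : (projectiveArrangementsFixed G u).expect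
        (fun π => sumEdgeLengths (G.deleteIncidenceSet u) π) =
      (projectiveArrangements G u).expect
        fun π => sumEdgeLengths (G.deleteIncidenceSet u) π := by
    rw [← filter_branch_first_projectiveArrangements]
    exact hsymm.expect_filter_first (fun π hπ σ => sumEdgeLengths_permuteBlocks
      (fun _ _ => SimpleGraph.ConnectedComponent.connectedComponentMk_eq_of_adj)
      (hsymm π hπ).1) _
  simp only [expProjectiveFixed, expProjective, sumEdgeLengths_eq_sum_neighborFinset_add G u,
    expect_add_distrib, hinner, expect_sum_comm]
  rw [add_right_comm, ← sum_add_distrib]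
  congr 1
  refine sum_congr rfl fun v hv => ?_
  have huv : u ≠ v := ((G.mem_neighborFinset u v).1 hv).ne
  rw [expect_dist_root_fixed hne huv, hsymm.expect_dist (hne.mono (filter_subset _ _))
    (fun _ => branch_eq_branch_root_iff) huv.symm, sub_add_cancel]

open scoped Classical in
theorem sum_card_branch (hG : G.IsTree) (u : V) :
    ∑ v ∈ G.neighborFinset u, #{x | branch G u x = branch G u v} = Fintype.card V - 1 := by
  rw [← card_biUnion, ← card_univ, ← card_erase_of_mem (mem_univ u)]
  · congr 1
    ext x
    simp only [mem_biUnion, SimpleGraph.mem_neighborFinset, mem_filter_univ, mem_erase, mem_univ,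
      and_true]
    constructor
    · rintro ⟨v, huv, hxv⟩ rfl
      exact huv.ne (branch_eq_branch_root_iff.1 hxv.symm).symm
    · intro hxu
      obtain ⟨v, huv, hv⟩ := exists_adj_root_branch_eq hG.connected hxu
      exact ⟨v, huv, hv.symm⟩
  · intro v hv w hw hvw
    refine disjoint_filter.2 fun x _ hxv hxw => hvw ?_
    exact eq_of_adj_root_of_branch_eq hG.isAcyclic ((G.mem_neighborFinset u v).1 hv)
      ((G.mem_neighborFinset u w).1 hw) (hxv.symm.trans hxw)

open scoped Classical in
theorem expProjectiveFixed_eq_of_isTree (hG : G.IsTree) (u : V) :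
    expProjectiveFixed G u =
      expProjective G u + ((G.degree u : ℝ) - 1) * ((Fintype.card V : ℝ) - 1) / 6 := by
  have := hG.connected.nonempty
  have hcard : ∑ v ∈ G.neighborFinset u, (#{x | branch G u x = branch G u v} : ℝ) =
      (Fintype.card V : ℝ) - 1 := by
    rw [← Nat.cast_sum, sum_card_branch hG, Nat.cast_sub Fintype.card_pos, Nat.cast_one]
  rw [expProjectiveFixed_eq_of_connected hG.connected (projectiveArrangementsFixed_nonempty hG u),
    ← sum_div, sum_sub_distrib, hcard, sum_const, SimpleGraph.card_neighborFinset_eq_degree,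
    nsmul_eq_mul]
  ring

theorem sum_expProjectiveFixed (hG : G.IsTree) :
    ∑ u, expProjectiveFixed G u = ∑ u, expProjective G u +
      ((Fintype.card V : ℝ) - 1) * ((Fintype.card V : ℝ) - 2) / 6 := by
  classical
  have hdeg : ∑ u, (G.degree u : ℝ) = 2 * ((Fintype.card V : ℝ) - 1) := by
    rw [← hG.card_edgeFinset, ← Nat.cast_sum, G.sum_degrees_eq_twice_card_edges]
    push_cast
    ring
  simp only [expProjectiveFixed_eq_of_isTree hG, sum_add_distrib]
  rw [← sum_div, ← sum_mul, sum_sub_distrib, hdeg, sum_const, card_univ, nsmul_eq_mul]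
  ring

end Expectation

end LinArr

/- The first three conjuncts say that the expectations are taken over nonempty sets of
arrangements. -/
theorem theorem1 {V : Type*} [Fintype V] (G : SimpleGraph V) (hG : G.IsTree) :
    (LinArr.planarArrangements G).Nonempty ∧
    (∀ u : V, (LinArr.projectiveArrangementsFixed G u).Nonempty) ∧
    (∀ u : V, (LinArr.projectiveArrangements G u).Nonempty) ∧
    LinArr.expPlanar G
      = 1 / (Fintype.card V : ℝ) * ∑ u : V, LinArr.expProjectiveFixed G u ∧
    LinArr.expPlanar G
      = ((Fintype.card V : ℝ) - 1) * ((Fintype.card V : ℝ) - 2) / (6 * (Fintype.card V : ℝ))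
        + 1 / (Fintype.card V : ℝ) * ∑ u : V, LinArr.expProjective G u := by
  have := hG.connected.nonempty
  refine ⟨LinArr.planarArrangements_nonempty hG, LinArr.projectiveArrangementsFixed_nonempty hG,
    LinArr.projectiveArrangements_nonempty hG, LinArr.expPlanar_eq_average G, ?_⟩
  rw [LinArr.expPlanar_eq_average, LinArr.sum_expProjectiveFixed hG]
  field_simp
  ring
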